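/- Let $p$ be a prime. A \emph{cyclotomic pro-$p$ pair} is a pair $\mathcal G=(G,\theta)$ consisting of a pro-$p$ group $G$ and a continuous homomorphism $\theta\colon G\to 1+p\mathbb Z_p$; an isomorphism of pairs is an isomorphism of topological groups compatible with the characters. Write $H^i(G)=H^i(G,\mathbb Z/p)$ for profinite cohomology with trivial action. The pair $\mathcal G$ is of \emph{Demuškin type} if (1) $G$ is a Demuškin group, that is, its rank $\dim_{\mathbb F_p}H^1(G)$ is finite, $\dim_{\mathbb F_p}H^2(G)=1$, and the cup product $H^1(G)\times H^1(G)\to H^2(G)$ is non-degenerate; and (2) $\theta$ is the canonical character of $G$, i.e. the one for which $\mathcal G$ has the formal Hilbert 90 property: for every $k\ge1$ the natural map $H^1(G,\mathbb Z/p^k(1))\to H^1(G,\mathbb Z/p)$ is surjective, where $\mathbb Z/p^k(1)$ is the group $\mathbb Z/p^k$ with the $G$-action $g\cdot a=\theta(g)a$. The rank of $\mathcal G$ is the rank of $G$. For a cyclotomic pro-$p$ pair $\bar{\mathcal G}=(\bar G,\bar\theta)$, the \emph{extension} $\mathbb Z_p\rtimes\bar{\mathcal G}$ is the pair $(\mathbb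 Z_p\rtimes\bar G,\ \bar\theta\circ\pi)$, where $\bar G$ acts on $\mathbb Z_p$ by $\bar g a\bar g^{-1}=\bar\theta(\bar g)a$ and $\pi\colon\mathbb Z_p\rtimes\bar G\to\bar G$ is the projection. \textbf{Lemma.} Let $\mathcal G$ be a cyclotomic pro-$p$ pair of Demuškin type and of rank at least $3$. Then there is no cyclotomic pro-$p$ pair $\bar{\mathcal G}$ such that $\mathcal G\cong\mathbb Z_p\rtimes\bar{\mathcal G}$. -/

import Mathlib

universe u v w

/-! ### Continuous cohomology in degrees one and two

`ρ` is a representation of the topological group `G` on a discrete `R`-module `M`; cohomology is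
computed by continuous inhomogeneous cochains. -/

section Cohomology

variable {R : Type v} [CommRing R] {G : Type u} [Group G] [TopologicalSpace G]
  {M : Type w} [AddCommGroup M] [Module R M] [TopologicalSpace M] [DiscreteTopology M]

/-- Continuous 1-cocycles: `f (g h) = f g + g • f h`. -/
def contCocycles₁ (ρ : Representation R G M) : Submodule R (G → M) where
  carrier := {f | Continuous f ∧ ∀ g h : G, f (g * h) = f g + ρ g (f h)}
  zero_mem' := ⟨continuous_const, fun g h => by simp⟩
  add_mem' := by
    rintro a b ⟨ha, ha'⟩ ⟨hb, hb'⟩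
    refine ⟨ha.add hb, fun g h => ?_⟩
    simp only [Pi.add_apply, ha', hb', map_add]
    abel
  smul_mem' := by
    rintro r a ⟨ha, ha'⟩
    refine ⟨(continuous_of_discreteTopology (f := fun m : M => r • m)).comp ha, fun g h => ?_⟩
    simp only [Pi.smul_apply, ha', map_smul, smul_add]

/-- 1-coboundaries, `f g = g • m - m`. -/
def contCoboundaries₁ (ρ : Representation R G M) : Submodule R (contCocycles₁ ρ) where
  carrier := {f | ∃ m : M, ∀ g : G, f.1 g = ρ g m - m}
  zero_mem' := ⟨0, fun g => by simp⟩
  add_mem' := by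
    rintro a b ⟨m, hm⟩ ⟨n, hn⟩
    refine ⟨m + n, fun g => ?_⟩
    simp only [Submodule.coe_add, Pi.add_apply, hm, hn, map_add]
    abel
  smul_mem' := by
    rintro r a ⟨m, hm⟩
    refine ⟨r • m, fun g => ?_⟩
    simp only [Submodule.coe_smul, Pi.smul_apply, hm, map_smul, smul_sub]

/-- `H¹(G, M)`. -/
abbrev ContH1 (ρ : Representation R G M) : Type (max u w) :=
  contCocycles₁ ρ ⧸ contCoboundaries₁ ρ

/-- Continuous 2-cocycles: `g • f (h, k) - f (g h, k) + f (g, h k) - f (g, h) = 0`. -/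
def contCocycles₂ (ρ : Representation R G M) : Submodule R (G × G → M) where
  carrier := {f | Continuous f ∧ ∀ g h k : G,
    ρ g (f (h, k)) - f (g * h, k) + f (g, h * k) - f (g, h) = 0}
  zero_mem' := ⟨continuous_const, fun g h k => by simp⟩
  add_mem' := by
    rintro a b ⟨ha, ha'⟩ ⟨hb, hb'⟩
    refine ⟨ha.add hb, fun g h k => ?_⟩
    have h1 := ha' g h k
    have h2 := hb' g h k
    simp only [Pi.add_apply, map_add]
    calc _ = (ρ g (a (h, k)) - a (g * h, k) + a (g, h * k) - a (g, h))
          + (ρ g (b (h, k)) - b (g * h, k) + b (g, h * k) - b (g, h)) := by abel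
      _ = 0 := by rw [h1, h2, add_zero]
  smul_mem' := by
    rintro r a ⟨ha, ha'⟩
    refine ⟨(continuous_of_discreteTopology (f := fun m : M => r • m)).comp ha, fun g h k => ?_⟩
    simp only [Pi.smul_apply, map_smul, ← smul_sub, ← smul_add, ha', smul_zero]

/-- 2-coboundaries of continuous 1-cochains, `f (g, h) = g • c h - c (g h) + c g`. -/
def contCoboundaries₂ (ρ : Representation R G M) : Submodule R (contCocycles₂ ρ) where
  carrier := {f | ∃ c : G → M, Continuous c ∧
    ∀ g h : G, f.1 (g, h) = ρ g (c h) - c (g * h) + c g}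
  zero_mem' := ⟨0, continuous_const, fun g h => by simp⟩
  add_mem' := by
    rintro a b ⟨c, hc, hc'⟩ ⟨d, hd, hd'⟩
    refine ⟨c + d, hc.add hd, fun g h => ?_⟩
    simp only [Submodule.coe_add, Pi.add_apply, hc', hd', map_add]
    abel
  smul_mem' := by
    rintro r a ⟨c, hc, hc'⟩
    refine ⟨r • c, (continuous_of_discreteTopology (f := fun m : M => r • m)).comp hc,
      fun g h => ?_⟩
    simp only [Submodule.coe_smul, Pi.smul_apply, hc', map_smul, smul_sub, smul_add]

/-- `H²(G, M)`. -/
abbrev ContH2 (ρ : Representation R G M) : Type (max u w) :=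
  contCocycles₂ ρ ⧸ contCoboundaries₂ ρ

end Cohomology

/-! ### Trivial coefficients `ℤ/p` and the cup product -/

section CupProduct

variable (p : ℕ) (G : Type u) [Group G] [TopologicalSpace G]

/-- `ℤ/p` with the trivial action of `G`. -/
abbrev trivRep : Representation (ZMod p) G (ZMod p) := Representation.trivial (ZMod p) G (ZMod p)

/-- `H¹(G) = H¹(G, ℤ/p)`. -/
abbrev H1p : Type u := ContH1 (trivRep p G)

/-- `H²(G) = H²(G, ℤ/p)`. -/
abbrev H2p : Type u := ContH2 (trivRep p G)

/-- The cup product on cochains, `(a ∪ b) (g, h) = a g * b h`. -/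
def cupCocycle (a b : contCocycles₁ (trivRep p G)) : contCocycles₂ (trivRep p G) :=
  ⟨fun x => a.1 x.1 * b.1 x.2,
    (a.2.1.comp continuous_fst).mul (b.2.1.comp continuous_snd), fun g h k => by
      have h1 := a.2.2 g h
      have h2 := b.2.2 h k
      simp only [Representation.isTrivial_def, LinearMap.id_apply] at h1 h2 ⊢
      rw [h1, h2]
      ring⟩

/-- The cup product as a bilinear map on cocycles with values in `H²(G)`. -/
def cupOnCocycles :
    contCocycles₁ (trivRep p G) →ₗ[ZMod p] contCocycles₁ (trivRep p G) →ₗ[ZMod p] H2p p G :=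
  (LinearMap.mk₂ (ZMod p) (cupCocycle p G)
    (fun a b c => Subtype.ext (funext fun x => add_mul (a.1 x.1) (b.1 x.1) (c.1 x.2)))
    (fun r a b => Subtype.ext (funext fun x => mul_assoc r (a.1 x.1) (b.1 x.2)))
    (fun a b c => Subtype.ext (funext fun x => mul_add (a.1 x.1) (b.1 x.2) (c.1 x.2)))
    (fun r a b => Subtype.ext (funext fun x => mul_left_comm (a.1 x.1) r (b.1 x.2)))).compr₂
    (contCoboundaries₂ (trivRep p G)).mkQ

theorem eq_zero_of_mem_contCoboundaries₁ {a : contCocycles₁ (trivRep p G)}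
    (ha : a ∈ contCoboundaries₁ (trivRep p G)) : a = 0 := by
  obtain ⟨m, hm⟩ := ha
  refine Subtype.ext (funext fun g => ?_)
  rw [hm g]
  simp

/-- The cup product `H¹(G) × H¹(G) → H²(G)`. -/
def cupProduct : H1p p G →ₗ[ZMod p] H1p p G →ₗ[ZMod p] H2p p G :=
  LinearMap.liftQ₂ _ _ (cupOnCocycles p G)
    (fun a ha => by rw [eq_zero_of_mem_contCoboundaries₁ p G ha]; exact Submodule.zero_mem _)
    (fun a ha => by rw [eq_zero_of_mem_contCoboundaries₁ p G ha]; exact Submodule.zero_mem _)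

end CupProduct

/-! ### Pro-`p` groups and Demuškin groups -/

/-- A pro-`p` group: a profinite group all of whose quotients by open normal subgroups are
`p`-groups. -/
structure IsProPGroup (p : ℕ) (G : Type u) [Group G] [TopologicalSpace G] : Prop where
  topologicalGroup : IsTopologicalGroup G
  compact : CompactSpace G
  hausdorff : T2Space G
  totallyDisconnected : TotallyDisconnectedSpace G
  isPGroup_quotient : ∀ (U : Subgroup G) [U.Normal], IsOpen (U : Set G) → IsPGroup p (G ⧸ U)

section Demushkin

variable (p : ℕ) [Fact p.Prime] (G : Type u) [Group G] [TopologicalSpace G]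

/-- The rank of a pro-`p` group, `dim H¹(G)`. -/
noncomputable def proPRank : Cardinal.{u} := Module.rank (ZMod p) (H1p p G)

/-- Demuškin pro-`p` groups. -/
structure IsDemushkinGroup : Prop where
  isProPGroup : IsProPGroup p G
  rank_lt_aleph0 : proPRank p G < Cardinal.aleph0
  rank_H2 : Module.rank (ZMod p) (H2p p G) = 1
  nondegenerate : (cupProduct p G).Nondegenerate

end Demushkin

/-! ### Cyclotomic pro-`p` pairs -/

/-- A cyclotomic pro-`p` pair `(G, θ)`: a pro-`p` group `G` and a continuous homomorphism
`θ : G → 1 + pℤ_p`. -/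
structure CyclotomicPair (p : ℕ) [Fact p.Prime] : Type (u + 1) where
  carrier : Type u
  [group : Group carrier]
  [topologicalSpace : TopologicalSpace carrier]
  isProPGroup : IsProPGroup p carrier
  θ : carrier →* ℤ_[p]ˣ
  continuous_θ : Continuous θ
  θ_one_unit : ∀ g : carrier, (p : ℤ_[p]) ∣ (θ g : ℤ_[p]) - 1

namespace CyclotomicPair

variable {p : ℕ} [Fact p.Prime]

instance : CoeSort (CyclotomicPair.{u} p) (Type u) := ⟨carrier⟩

instance instGroupCarrier (𝒢 : CyclotomicPair.{u} p) : Group 𝒢 := 𝒢.group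

instance instTopologicalSpaceCarrier (𝒢 : CyclotomicPair.{u} p) : TopologicalSpace 𝒢 :=
  𝒢.topologicalSpace

/-- An isomorphism of cyclotomic pro-`p` pairs: an isomorphism of topological groups compatible
with the characters. -/
structure Iso (𝒢 : CyclotomicPair.{u} p) (ℋ : CyclotomicPair.{v} p) where
  toEquiv : 𝒢 ≃ₜ* ℋ
  θ_comp : ∀ g : 𝒢, ℋ.θ (toEquiv g) = 𝒢.θ g

/-- The rank of a pair is the rank of its group. -/
noncomputable def rank (𝒢 : CyclotomicPair.{u} p) : Cardinal.{u} := proPRank p 𝒢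

/-! #### The formal Hilbert 90 property -/

/-- The `G`-module `ℤ/p^k(1)`: the group `ℤ/p^k`, on which `g` acts as multiplication by
`θ g mod p^k`. -/
noncomputable def twist (𝒢 : CyclotomicPair.{u} p) (k : ℕ) :
    Representation (ZMod (p ^ k)) 𝒢 (ZMod (p ^ k)) :=
  (Algebra.lmul (ZMod (p ^ k)) (ZMod (p ^ k)) : ZMod (p ^ k) →* _).comp
    (((PadicInt.toZModPow k : ℤ_[p] →+* ZMod (p ^ k)) : ℤ_[p] →* ZMod (p ^ k)).comp
      ((Units.coeHom ℤ_[p]).comp 𝒢.θ))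

theorem twist_apply (𝒢 : CyclotomicPair.{u} p) (k : ℕ) (g : 𝒢) (x : ZMod (p ^ k)) :
    𝒢.twist k g x = PadicInt.toZModPow k (𝒢.θ g : ℤ_[p]) * x := rfl

/-- The reduction `ℤ/p^k → ℤ/p` for `k ≥ 1`. -/
def reduction (p : ℕ) {k : ℕ} (hk : 1 ≤ k) : ZMod (p ^ k) →+* ZMod p :=
  ZMod.castHom (dvd_pow_self p (Nat.one_le_iff_ne_zero.mp hk)) (ZMod p)

theorem reduction_θ (𝒢 : CyclotomicPair.{u} p) {k : ℕ} (hk : 1 ≤ k) (g : 𝒢) :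
    reduction p hk (PadicInt.toZModPow k (𝒢.θ g : ℤ_[p])) = 1 := by
  obtain ⟨y, hy⟩ := 𝒢.θ_one_unit g
  rw [sub_eq_iff_eq_add.mp hy]
  simp

/-- Reduction of cocycles along `ℤ/p^k(1) → ℤ/p`. -/
noncomputable def reductionCocycles (𝒢 : CyclotomicPair.{u} p) {k : ℕ} (hk : 1 ≤ k) :
    contCocycles₁ (𝒢.twist k) →ₛₗ[reduction p hk] contCocycles₁ (trivRep p 𝒢) where
  toFun f := ⟨fun g => reduction p hk (f.1 g), continuous_of_discreteTopology.comp f.2.1,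
    fun g h => by
      have := f.2.2 g h
      rw [twist_apply] at this
      simp only [this, map_add, map_mul, reduction_θ, one_mul]
      rfl⟩
  map_add' a b := Subtype.ext (funext fun g => map_add (reduction p hk) (a.1 g) (b.1 g))
  map_smul' r a := Subtype.ext (funext fun g => map_mul (reduction p hk) r (a.1 g))

/-- The natural map `H¹(G, ℤ/p^k(1)) → H¹(G, ℤ/p)`. -/
noncomputable def reductionH1 (𝒢 : CyclotomicPair.{u} p) {k : ℕ} (hk : 1 ≤ k) :
    ContH1 (𝒢.twist k) →ₛₗ[reduction p hk] H1p p 𝒢 :=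
  Submodule.mapQ _ _ (𝒢.reductionCocycles hk) (by
    rintro a ⟨m, hm⟩
    refine ⟨reduction p hk m, fun g => ?_⟩
    change reduction p hk (a.1 g) = _
    rw [hm g, twist_apply, map_sub, map_mul, reduction_θ]
    simp)

/-- The formal Hilbert 90 property. -/
def FormalHilbert90 (𝒢 : CyclotomicPair.{u} p) : Prop :=
  ∀ (k : ℕ) (hk : 1 ≤ k), Function.Surjective (𝒢.reductionH1 hk)

/-- A pair `(G, θ)` of Demuškin type: `G` is a Demuškin group and `θ` is its canonical character,
that is, the character for which `(G, θ)` has the formal Hilbert 90 property. -/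
structure IsDemushkinType (𝒢 : CyclotomicPair.{u} p) : Prop where
  isDemushkinGroup : IsDemushkinGroup p 𝒢
  formalHilbert90 : 𝒢.FormalHilbert90

/-! #### Extensions `ℤ_p ⋊ 𝒢` -/

/-- The action of `G` on `ℤ_p` through `θ`, written multiplicatively. -/
noncomputable def action (𝒢 : CyclotomicPair.{u} p) : 𝒢 →* MulAut (Multiplicative ℤ_[p]) where
  toFun g := AddEquiv.toMultiplicative (DistribMulAction.toAddEquiv ℤ_[p] (𝒢.θ g))
  map_one' := by
    ext x
    apply Multiplicative.toAdd.injective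
    change 𝒢.θ 1 • x.toAdd = x.toAdd
    rw [map_one, one_smul]
  map_mul' g h := by
    ext x
    apply Multiplicative.toAdd.injective
    change 𝒢.θ (g * h) • x.toAdd = 𝒢.θ g • 𝒢.θ h • x.toAdd
    rw [map_mul, mul_smul]

theorem toAdd_action (𝒢 : CyclotomicPair.{u} p) (g : 𝒢) (x : Multiplicative ℤ_[p]) :
    (𝒢.action g x).toAdd = (𝒢.θ g : ℤ_[p]) * x.toAdd := rfl

/-- The semidirect product `ℤ_p ⋊ G` with respect to the action `g a g⁻¹ = θ(g) a`. -/
abbrev ExtGroup (𝒢 : CyclotomicPair.{u} p) : Type u := Multiplicative ℤ_[p] ⋊[𝒢.action] 𝒢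

/-- The product topology on `ℤ_p ⋊ G`. -/
noncomputable instance instTopologicalSpaceExtGroup (𝒢 : CyclotomicPair.{u} p) :
    TopologicalSpace 𝒢.ExtGroup :=
  TopologicalSpace.induced (fun x => (x.left.toAdd, x.right))
    (inferInstance : TopologicalSpace (ℤ_[p] × 𝒢))

/-- The underlying space of `ℤ_p ⋊ G` is the product space. -/
noncomputable def extHomeo (𝒢 : CyclotomicPair.{u} p) : 𝒢.ExtGroup ≃ₜ ℤ_[p] × 𝒢 where
  toFun x := (x.left.toAdd, x.right)
  invFun y := ⟨Multiplicative.ofAdd y.1, y.2⟩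
  left_inv _ := rfl
  right_inv _ := rfl
  continuous_toFun := continuous_induced_dom
  continuous_invFun := continuous_induced_rng.mpr continuous_id

theorem continuous_ext_iff (𝒢 : CyclotomicPair.{u} p) {X : Type*} [TopologicalSpace X]
    {f : X → 𝒢.ExtGroup} :
    Continuous f ↔ Continuous (fun x => (f x).left.toAdd) ∧ Continuous (fun x => (f x).right) :=
  continuous_induced_rng.trans continuous_prodMk

theorem isProPGroup_ext (𝒢 : CyclotomicPair.{u} p) : IsProPGroup p 𝒢.ExtGroup := by
  have hp : p.Prime := Fact.out
  have hG := 𝒢.isProPGroup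
  have := hG.topologicalGroup
  have := hG.compact
  have := hG.hausdorff
  have := hG.totallyDisconnected
  have hl : Continuous (fun x : 𝒢.ExtGroup => x.left.toAdd) :=
    continuous_fst.comp 𝒢.extHomeo.continuous
  have hr : Continuous (fun x : 𝒢.ExtGroup => x.right) :=
    continuous_snd.comp 𝒢.extHomeo.continuous
  have hθ : Continuous (fun g : 𝒢 => (𝒢.θ g : ℤ_[p])) :=
    Units.continuous_val.comp 𝒢.continuous_θ
  have htop : IsTopologicalGroup 𝒢.ExtGroup :=
    { continuous_mul := 𝒢.continuous_ext_iff.mpr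
        ⟨(hl.comp continuous_fst).add
            ((hθ.comp (hr.comp continuous_fst)).mul (hl.comp continuous_snd)),
          (hr.comp continuous_fst).mul (hr.comp continuous_snd)⟩
      continuous_inv := 𝒢.continuous_ext_iff.mpr
        ⟨(hθ.comp hr.inv).mul hl.neg, hr.inv⟩ }
  refine ⟨htop, 𝒢.extHomeo.symm.compactSpace, 𝒢.extHomeo.symm.t2Space,
    𝒢.extHomeo.symm.totallyDisconnectedSpace, fun U hU hopen q => ?_⟩
  obtain ⟨x, rfl⟩ := QuotientGroup.mk_surjective q
  -- the image of `U` in `G` is open and normal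
  let V : Subgroup 𝒢 := U.map SemidirectProduct.rightHom
  have hV : V.Normal := hU.map _ SemidirectProduct.rightHom_surjective
  have hVopen : IsOpen (V : Set 𝒢) :=
    (isOpenMap_snd.comp 𝒢.extHomeo.isOpenMap) _ hopen
  obtain ⟨k, hk⟩ := hG.isPGroup_quotient V hVopen (QuotientGroup.mk x.right)
  rw [← QuotientGroup.mk_pow, QuotientGroup.eq_one_iff] at hk
  obtain ⟨u, huU, hu⟩ := hk
  -- modulo `U`, the element `x ^ p ^ k` lies in `ℤ_p`
  let a : ℤ_[p] := (x ^ p ^ k * u⁻¹).left.toAdd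
  have ha : x ^ p ^ k * u⁻¹ = SemidirectProduct.inl (Multiplicative.ofAdd a) := by
    refine SemidirectProduct.ext rfl ?_
    change SemidirectProduct.rightHom (x ^ p ^ k * u⁻¹) = 1
    rw [map_mul, map_inv, hu, map_pow]
    exact mul_inv_cancel _
  have hlim : Filter.Tendsto (fun m : ℕ => (p : ℤ_[p]) ^ m * a) Filter.atTop (nhds 0) := by
    have h0 : Filter.Tendsto (fun m : ℕ => (p : ℤ_[p]) ^ m) Filter.atTop (nhds 0) :=
      tendsto_pow_atTop_nhds_zero_of_norm_lt_one
        (by rw [PadicInt.norm_p]; exact inv_lt_one_of_one_lt₀ (by exact_mod_cast hp.one_lt))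
    simpa using h0.mul_const a
  have hinl : Continuous (fun b : ℤ_[p] =>
      (SemidirectProduct.inl (Multiplicative.ofAdd b) : 𝒢.ExtGroup)) :=
    𝒢.continuous_ext_iff.mpr ⟨continuous_id, continuous_const⟩
  have hmem : ∀ᶠ m : ℕ in Filter.atTop,
      (SemidirectProduct.inl (Multiplicative.ofAdd ((p : ℤ_[p]) ^ m * a)) : 𝒢.ExtGroup) ∈ U := by
    refine ((hinl.tendsto 0).comp hlim).eventually (hopen.mem_nhds ?_)
    exact U.one_mem
  obtain ⟨m, hm⟩ := hmem.exists
  refine ⟨k + m, ?_⟩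
  have hx : (QuotientGroup.mk x : 𝒢.ExtGroup ⧸ U) ^ p ^ k
      = QuotientGroup.mk (SemidirectProduct.inl (Multiplicative.ofAdd a)) := by
    rw [← ha, QuotientGroup.mk_mul, QuotientGroup.mk_inv, (QuotientGroup.eq_one_iff u).mpr huU,
      inv_one, mul_one, QuotientGroup.mk_pow]
  rw [pow_add, pow_mul, hx, ← QuotientGroup.mk_pow, QuotientGroup.eq_one_iff, ← map_pow,
    ← ofAdd_nsmul, nsmul_eq_mul]
  exact_mod_cast hm

/-- The extension `ℤ_p ⋊ 𝒢 = (ℤ_p ⋊ G, θ ∘ π)`, with `π` the projection to `G`. -/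
noncomputable def extension (𝒢 : CyclotomicPair.{u} p) : CyclotomicPair.{u} p where
  carrier := 𝒢.ExtGroup
  isProPGroup := 𝒢.isProPGroup_ext
  θ := 𝒢.θ.comp SemidirectProduct.rightHom
  continuous_θ := 𝒢.continuous_θ.comp (continuous_snd.comp 𝒢.extHomeo.continuous)
  θ_one_unit x := 𝒢.θ_one_unit x.right

end CyclotomicPair

/-! In a split extension `G = ℤ_p ⋊ H` with `θ ≡ 1` mod `p`, the `ℤ_p`-coordinate mod `p` is a class
`χ` in `H¹(G)`. Cupping with `χ` is injective on the classes that vanish on `ℤ_p`, which form a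
subspace of codimension at most one. Hence `dim H¹(G) ≤ 1 + dim H²(G) = 2` when `dim H²(G) = 1`,
against rank at least 3.

Injectivity (`Iso.eq_zero_of_cup_eq_zero`) is a cochain computation: if `χ ∪ b = δc`, evaluate both
sides at the two factorizations of one element given by `h a = (θ(h) a) h`, for `h` in `H` and `a`
the generator of `ℤ_p`. `Iso.rank_le_two` is the dimension count. -/

/-- Every additive map `ℤ_p → ℤ/p` is a multiple of the reduction. -/
theorem PadicInt.addMonoidHom_zmod_apply {p : ℕ} [Fact p.Prime] (f : ℤ_[p] →+ ZMod p)
    (x : ℤ_[p]) : f x = PadicInt.toZMod x * f 1 := by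
  obtain ⟨n, hn⟩ : ∃ n : ℕ, PadicInt.toZMod x = (n : ZMod p) :=
    ⟨(PadicInt.toZMod x).val, (ZMod.natCast_zmod_val _).symm⟩
  have hmem : x - n ∈ IsLocalRing.maximalIdeal ℤ_[p] := by
    rw [← PadicInt.ker_toZMod, RingHom.mem_ker, map_sub, map_natCast, hn, sub_self]
  rw [PadicInt.maximalIdeal_eq_span_p, Ideal.mem_span_singleton] at hmem
  obtain ⟨y, hy⟩ := hmem
  -- Natural multiples are respected by any additive map, and `p • y` dies in `ℤ/p`; no continuity
  -- of `f` is needed.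
  have hx : x = n • (1 : ℤ_[p]) + p • y := by
    rw [nsmul_eq_mul, nsmul_eq_mul, ← hy]
    ring
  rw [hn]
  conv_lhs => rw [hx]
  rw [map_add, map_nsmul, map_nsmul, nsmul_eq_mul, nsmul_eq_mul, ZMod.natCast_self, zero_mul,
    add_zero]

theorem PadicInt.continuous_toZMod (p : ℕ) [Fact p.Prime] :
    Continuous (PadicInt.toZMod : ℤ_[p] → ZMod p) := by
  refine continuous_of_continuousAt_zero (PadicInt.toZMod : ℤ_[p] →+* ZMod p) ?_
  rw [ContinuousAt, map_zero, nhds_discrete (ZMod p), Filter.tendsto_pure]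
  -- The open unit ball is `pℤ_p`, the kernel of reduction.
  filter_upwards [Metric.ball_mem_nhds (0 : ℤ_[p]) one_pos] with x hx
  rw [← RingHom.mem_ker, PadicInt.ker_toZMod, PadicInt.maximalIdeal_eq_span_p,
    Ideal.mem_span_singleton, ← PadicInt.norm_lt_one_iff_dvd]
  exact mem_ball_zero_iff.mp hx

theorem contCocycles₁_trivRep_map_mul {p : ℕ} {G : Type u} [Group G] [TopologicalSpace G]
    (b : contCocycles₁ (trivRep p G)) (g h : G) : b.1 (g * h) = b.1 g + b.1 h :=
  b.2.2 g h

/-! ### Coordinates on a split extension -/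

namespace CyclotomicPair

variable {p : ℕ} [Fact p.Prime] {𝒢 : CyclotomicPair.{u} p} {ℋ : CyclotomicPair.{v} p}

theorem toZMod_θ (𝒢 : CyclotomicPair.{u} p) (g : 𝒢) : PadicInt.toZMod (𝒢.θ g : ℤ_[p]) = 1 := by
  obtain ⟨y, hy⟩ := 𝒢.θ_one_unit g
  rw [sub_eq_iff_eq_add.mp hy]
  simp

/-- The inclusion `ℤ_p → ℤ_p ⋊ H ≅ G`. -/
noncomputable def Iso.kernelHom (e : Iso 𝒢 ℋ.extension) : Multiplicative ℤ_[p] →* 𝒢 :=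
  (e.toEquiv.symm : ℋ.extension ≃* 𝒢).toMonoidHom.comp
    (SemidirectProduct.inl : _ →* ℋ.ExtGroup)

/-- The section `H → ℤ_p ⋊ H ≅ G`. -/
noncomputable def Iso.sectionHom (e : Iso 𝒢 ℋ.extension) : ℋ →* 𝒢 :=
  (e.toEquiv.symm : ℋ.extension ≃* 𝒢).toMonoidHom.comp
    (SemidirectProduct.inr : _ →* ℋ.ExtGroup)

/-- The first coordinate of an element of `G ≅ ℤ_p ⋊ H`. -/
noncomputable def Iso.coord (e : Iso 𝒢 ℋ.extension) (g : 𝒢) : ℤ_[p] :=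
  (show ℋ.ExtGroup from e.toEquiv g).left.toAdd

theorem Iso.sectionHom_mul_kernelHom (e : Iso 𝒢 ℋ.extension) (h : ℋ) (x : ℤ_[p]) :
    e.sectionHom h * e.kernelHom (Multiplicative.ofAdd x)
      = e.kernelHom (Multiplicative.ofAdd (ℋ.θ h * x)) * e.sectionHom h := by
  have := SemidirectProduct.inl_aut (φ := ℋ.action) h (Multiplicative.ofAdd x)
  have h2 : (SemidirectProduct.inr h * SemidirectProduct.inl (Multiplicative.ofAdd x)
      : ℋ.ExtGroup) =
      SemidirectProduct.inl (ℋ.action h (Multiplicative.ofAdd x)) * SemidirectProduct.inr h := by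
    rw [this, mul_assoc _ (SemidirectProduct.inr h⁻¹), ← map_mul, inv_mul_cancel, map_one, mul_one]
  exact (map_mul e.toEquiv.symm _ _).symm.trans
    ((congrArg e.toEquiv.symm h2).trans (map_mul e.toEquiv.symm _ _))

theorem Iso.exists_eq_kernelHom_mul_sectionHom (e : Iso 𝒢 ℋ.extension) (g : 𝒢) :
    ∃ (x : ℤ_[p]) (h : ℋ), g = e.kernelHom (Multiplicative.ofAdd x) * e.sectionHom h := by
  let y : ℋ.ExtGroup := e.toEquiv g
  refine ⟨y.left.toAdd, y.right, ?_⟩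
  exact (e.toEquiv.symm_apply_apply g).symm.trans ((congrArg e.toEquiv.symm
    (SemidirectProduct.inl_left_mul_inr_right y).symm).trans (map_mul e.toEquiv.symm _ _))

theorem Iso.coord_kernelHom (e : Iso 𝒢 ℋ.extension) (x : ℤ_[p]) :
    e.coord (e.kernelHom (Multiplicative.ofAdd x)) = x :=
  congrArg (fun y : ℋ.ExtGroup => y.left.toAdd) (e.toEquiv.apply_symm_apply _)

theorem Iso.coord_sectionHom (e : Iso 𝒢 ℋ.extension) (h : ℋ) :
    e.coord (e.sectionHom h) = 0 :=
  congrArg (fun y : ℋ.ExtGroup => y.left.toAdd) (e.toEquiv.apply_symm_apply _)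

theorem Iso.continuous_coord (e : Iso 𝒢 ℋ.extension) : Continuous e.coord :=
  (continuous_fst.comp ℋ.extHomeo.continuous).comp e.toEquiv.continuous

/-- The coordinate is a crossed homomorphism. Which `k` occurs is irrelevant below: `θ k` reduces to
1, so the coordinate mod `p` is a homomorphism. -/
theorem Iso.coord_mul (e : Iso 𝒢 ℋ.extension) (g h : 𝒢) :
    ∃ k : ℋ, e.coord (g * h) = e.coord g + ℋ.θ k * e.coord h :=
  ⟨(show ℋ.ExtGroup from e.toEquiv g).right,
    congrArg (fun y : ℋ.ExtGroup => y.left.toAdd) (map_mul e.toEquiv g h)⟩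

/-! ### Cup product with the coordinate class -/

/-- The class in `H¹(G)` of the first coordinate modulo `p`. -/
noncomputable def Iso.coordCocycle (e : Iso 𝒢 ℋ.extension) : contCocycles₁ (trivRep p 𝒢) :=
  ⟨fun g => PadicInt.toZMod (e.coord g),
    (PadicInt.continuous_toZMod p).comp e.continuous_coord, fun g h => by
      obtain ⟨k, hk⟩ := e.coord_mul g h
      change PadicInt.toZMod (e.coord (g * h)) =
        PadicInt.toZMod (e.coord g) + PadicInt.toZMod (e.coord h)
      rw [hk, map_add, map_mul, toZMod_θ, one_mul]⟩

/-- The restriction to `ℤ_p` of a map `G → ℤ/p` that is additive on `ℤ_p`. -/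
noncomputable def Iso.restrict (e : Iso 𝒢 ℋ.extension) (c : 𝒢 → ZMod p)
    (hc : ∀ x y : ℤ_[p], c (e.kernelHom (.ofAdd x) * e.kernelHom (.ofAdd y))
      = c (e.kernelHom (.ofAdd x)) + c (e.kernelHom (.ofAdd y))) : ℤ_[p] →+ ZMod p :=
  AddMonoidHom.mk' (fun x => c (e.kernelHom (.ofAdd x))) fun x y => by
    rw [← hc, ← map_mul, ofAdd_add]

/-- A cochain `c` bounding `χ ∪ b` takes the same value at the generator of `ℤ_p` and at its
conjugates by `H`. Comparing `δc` on the two orders of multiplication then leaves only `b h`, so `b`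
vanishes on `H` as well as on `ℤ_p`. -/
theorem Iso.eq_zero_of_cup_eq_zero (e : Iso 𝒢 ℋ.extension) (b : contCocycles₁ (trivRep p 𝒢))
    (h1 : b.1 (e.kernelHom (Multiplicative.ofAdd 1)) = 0)
    (hcup : cupOnCocycles p 𝒢 e.coordCocycle b = 0) : b = 0 := by
  have hker (x : ℤ_[p]) : b.1 (e.kernelHom (Multiplicative.ofAdd x)) = 0 := by
    have := PadicInt.addMonoidHom_zmod_apply
      (e.restrict b.1 fun _ _ => contCocycles₁_trivRep_map_mul b _ _) x
    exact this.trans (mul_eq_zero_of_right _ h1)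
  obtain ⟨c, -, hc⟩ := (Submodule.Quotient.mk_eq_zero _).mp hcup
  replace hc (g h : 𝒢) :
      PadicInt.toZMod (e.coord g) * b.1 h = c h - c (g * h) + c g := hc g h
  -- Since `b` vanishes on `ℤ_p`, so does `χ ∪ b` on pairs from `ℤ_p`, and `c` is additive there.
  have hadd (x y : ℤ_[p]) : c (e.kernelHom (.ofAdd x) * e.kernelHom (.ofAdd y))
      = c (e.kernelHom (.ofAdd x)) + c (e.kernelHom (.ofAdd y)) := by
    have := hc (e.kernelHom (.ofAdd x)) (e.kernelHom (.ofAdd y))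
    rw [hker, mul_zero] at this
    linear_combination this
  have hθ (h : ℋ) : c (e.kernelHom (.ofAdd ((ℋ.θ h : ℤ_[p]) * 1)))
      = c (e.kernelHom (.ofAdd 1)) := by
    have := PadicInt.addMonoidHom_zmod_apply (e.restrict c hadd) ((ℋ.θ h : ℤ_[p]) * 1)
    rw [map_mul PadicInt.toZMod, toZMod_θ, map_one, one_mul, one_mul] at this
    exact this
  have hsec (h : ℋ) : b.1 (e.sectionHom h) = 0 := by
    -- The two pairs have the same product, so the `c`-terms agree. The cup product is `b h` on the
    -- first pair, as `θ h ≡ 1`, and 0 on the second, as `χ` vanishes on `H`.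
    have e1 := hc (e.kernelHom (.ofAdd ((ℋ.θ h : ℤ_[p]) * 1))) (e.sectionHom h)
    have e2 := hc (e.sectionHom h) (e.kernelHom (.ofAdd 1))
    rw [← e.sectionHom_mul_kernelHom, e.coord_kernelHom, map_mul, toZMod_θ, map_one, hθ] at e1
    rw [e.coord_sectionHom, map_zero] at e2
    linear_combination e1 - e2
  refine Subtype.ext (funext fun g => ?_)
  obtain ⟨x, h, rfl⟩ := e.exists_eq_kernelHom_mul_sectionHom g
  rw [contCocycles₁_trivRep_map_mul, hker, hsec, add_zero]
  rfl

/-- A one-dimensional `H²(ℤ_p ⋊ H)` forces `dim H¹(ℤ_p ⋊ H) ≤ 2`. -/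
theorem Iso.rank_le_two (e : Iso 𝒢 ℋ.extension)
    (h2 : Module.rank (ZMod p) (H2p p 𝒢) = 1) : 𝒢.rank ≤ 2 := by
  let ev : contCocycles₁ (trivRep p 𝒢) →ₗ[ZMod p] ZMod p :=
    (LinearMap.proj (e.kernelHom (Multiplicative.ofAdd 1))).comp (Submodule.subtype _)
  let L := ev.prod (cupOnCocycles p 𝒢 e.coordCocycle)
  have hL : Function.Injective L := by
    refine (injective_iff_map_eq_zero L).mpr fun b hb => ?_
    exact e.eq_zero_of_cup_eq_zero b (congrArg Prod.fst hb) (congrArg Prod.snd hb)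
  -- Passing to the quotient by coboundaries cannot raise the rank, so bounding the cocycles
  -- suffices.
  calc 𝒢.rank ≤ Module.rank (ZMod p) (contCocycles₁ (trivRep p 𝒢)) := rank_quotient_le _
    _ ≤ Module.rank (ZMod p) (ZMod p × H2p p 𝒢) := LinearMap.rank_le_of_injective L hL
    _ = 2 := by
      rw [rank_prod, Module.rank_self, h2, Cardinal.lift_one, Cardinal.lift_one, one_add_one_eq_two]

end CyclotomicPair

theorem mainTheorem11 (p : ℕ) [Fact p.Prime] (𝒢 : CyclotomicPair.{u} p)
    (h𝒢 : 𝒢.IsDemushkinType) (hrank : 3 ≤ 𝒢.rank) (𝒢bar : CyclotomicPair.{v} p) :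
    ¬ Nonempty (CyclotomicPair.Iso 𝒢 𝒢bar.extension) := by
  rintro ⟨e⟩
  have h := hrank.trans (e.rank_le_two h𝒢.isDemushkinGroup.rank_H2)
  exact absurd h (by norm_num)
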